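/- Let $\mathcal G=([m],E)$ be a finite undirected graph and $n\ge 1$. Let $\mathcal S^+_{\mathcal G}$ be the set of positive definite symmetric $m\times m$ matrices $K$ with $K_{ij}=0$ whenever $i\ne j$ and $\{i,j\}\notin E$. Let $\mathrm{GL}_m(\mathbb R)$ act on symmetric matrices by $g\cdot K=g^{-T}Kg^{-1}$ and on samples $x\in\mathbb R^{m\times n}$ by $x\mapsto gx$, and put $G=\{g\in \mathrm{GL}_m(\mathbb R): g\cdot\mathcal S^+_{\mathcal G}\subseteq\mathcal S^+_{\mathcal G}\}$. With $N(i)$ the set of neighbours of $i$, write $i\preccurlyeq j$ if $N(j)\cup\{j\}\subseteq N(i)\cup\{i\}$, and let $G^0=\{g\in \mathrm{GL}_m(\mathbb R): g_{ij}=0\text{ whenever }j\not\preccurlyeq i\}$. For a sample $x$ (with columns regarded as independent observations of a centred Gaussian vector), let $\widehat\Sigma(x)$ be the maximum likelihood estimate of the covariance matrix among positive definite $\Sigma$ with $\Sigma^{-1}\in\mathcal S^+_{\mathcal G}$, let $M\subseteq\mathbb R^{m\times n}$ be the set of samples for which it exists, and put $S(x)=n\widehat\Sigma(x)$ for $x\in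 M$. A $G$-equivariant estimator of the concentration matrix is a map $T:D\to\mathcal S^+_{\mathcal G}$ on a $G$-stable set $D\subseteq\mathbb R^{m\times n}$ with $T(gx)=g\cdot T(x)$ for all $g\in G$, $x\in D$. **Proposition.** Suppose that $\mathcal G$ is decomposable (it has no induced $k$-cycle, $k\ge4$) and has no induced 4-chain (path on four vertices). Then there is a map $h:\mathbb R^{m\times n}\to G^0$ with $S(x)^{-1}=h(x)^Th(x)$ for all $x\in M$. Moreover, for every $G$-equivariant estimator $T:D\to\mathcal S^+_{\mathcal G}$ of the concentration matrix that depends on the sample only through $S$ (that is, $T(x)=\tau(S(x))$ on $D\cap M$ for some function $\tau$), there is a constant matrix $h_0\in G^0$ such that, for every such map $h$, $$T(x)=(h_0h(x))^T\,h_0h(x)\qquad\text{for all }x\in D\cap M.$$ -/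

import Mathlib

open Matrix

noncomputable section

namespace GaussianGraphical

variable {m n : ℕ}

/-- `𝒢` is decomposable: it has no induced `k`-cycle with `k ≥ 4`. -/
def IsDecomposable (𝒢 : SimpleGraph (Fin m)) : Prop :=
  ∀ k : ℕ, 4 ≤ k → ¬ (SimpleGraph.cycleGraph k).IsIndContained 𝒢

/-- `𝒢` has no induced 4-chain (path on four vertices). -/
def NoInducedFourChain (𝒢 : SimpleGraph (Fin m)) : Prop :=
  ¬ (SimpleGraph.pathGraph 4).IsIndContained 𝒢

/-- The linear space of symmetric matrices whose off-diagonal `(i, j)` entry vanishes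
whenever `{i, j}` is not an edge. -/
def symSpace (𝒢 : SimpleGraph (Fin m)) : Set (Matrix (Fin m) (Fin m) ℝ) :=
  {K | K.IsSymm ∧ ∀ i j, i ≠ j → ¬ 𝒢.Adj i j → K i j = 0}

/-- The cone of positive definite matrices in `symSpace 𝒢`: the concentration matrices of
the Gaussian graphical model of `𝒢`. -/
def concCone (𝒢 : SimpleGraph (Fin m)) : Set (Matrix (Fin m) (Fin m) ℝ) :=
  {K | K ∈ symSpace 𝒢 ∧ K.PosDef}

/-- The action `g · K = g⁻ᵀ K g⁻¹` of invertible matrices on symmetric matrices. -/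
def act (g : GL (Fin m) ℝ) (K : Matrix (Fin m) (Fin m) ℝ) : Matrix (Fin m) (Fin m) ℝ :=
  ((g⁻¹ : GL (Fin m) ℝ) : Matrix (Fin m) (Fin m) ℝ)ᵀ * K *
    ((g⁻¹ : GL (Fin m) ℝ) : Matrix (Fin m) (Fin m) ℝ)

/-- The group `G` of all `g ∈ GL_m(ℝ)` with `g · S⁺ ⊆ S⁺`, where `S⁺ = concCone 𝒢`. -/
def symmetryGroup (𝒢 : SimpleGraph (Fin m)) : Set (GL (Fin m) ℝ) :=
  {g | ∀ K ∈ concCone 𝒢, act g K ∈ concCone 𝒢}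

/-- The pre-order on vertices: `i ≼ j` iff `N(j) ∪ {j} ⊆ N(i) ∪ {i}`. -/
def VertexLE (𝒢 : SimpleGraph (Fin m)) (i j : Fin m) : Prop :=
  𝒢.neighborSet j ∪ {j} ⊆ 𝒢.neighborSet i ∪ {i}

/-- The group `G⁰` of all `g ∈ GL_m(ℝ)` with `g i j = 0` whenever `j ⋠ i`. -/
def identityComponent (𝒢 : SimpleGraph (Fin m)) : Set (GL (Fin m) ℝ) :=
  {g | ∀ i j, ¬ VertexLE 𝒢 j i → (g : Matrix (Fin m) (Fin m) ℝ) i j = 0}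

/-- The density of the centred normal distribution with (positive definite) covariance
matrix `C` at the point `v`. -/
def gaussianDensity (C : Matrix (Fin m) (Fin m) ℝ) (v : Fin m → ℝ) : ℝ :=
  (Real.sqrt ((2 * Real.pi) ^ m * C.det))⁻¹ * Real.exp (-(v ⬝ᵥ (C⁻¹ *ᵥ v)) / 2)

/-- The likelihood of the covariance matrix `C` given the sample `x`, whose `n` columns are
the observed vectors. -/
def likelihood (x : Matrix (Fin m) (Fin n) ℝ) (C : Matrix (Fin m) (Fin m) ℝ) : ℝ :=
  ∏ k : Fin n, gaussianDensity C (fun i => x i k)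

/-- The covariance matrices of the Gaussian graphical model of `𝒢`. -/
def modelCov (𝒢 : SimpleGraph (Fin m)) : Set (Matrix (Fin m) (Fin m) ℝ) :=
  {C | C.PosDef ∧ C⁻¹ ∈ concCone 𝒢}

/-- `C` is a maximum likelihood estimate of the covariance matrix in the Gaussian graphical
model of `𝒢`, given the sample `x`. -/
def IsMLE (𝒢 : SimpleGraph (Fin m)) (x : Matrix (Fin m) (Fin n) ℝ)
    (C : Matrix (Fin m) (Fin m) ℝ) : Prop :=
  C ∈ modelCov 𝒢 ∧ IsMaxOn (likelihood x) (modelCov 𝒢) C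

/-- The samples for which the maximum likelihood estimate exists. -/
def mleDomain (𝒢 : SimpleGraph (Fin m)) (n : ℕ) : Set (Matrix (Fin m) (Fin n) ℝ) :=
  {x | ∃ C, IsMLE 𝒢 x C}

open Classical in
/-- The maximum likelihood estimate of the covariance matrix (with the value `0`, never
used, at samples for which it does not exist). -/
def mle (𝒢 : SimpleGraph (Fin m)) (x : Matrix (Fin m) (Fin n) ℝ) :
    Matrix (Fin m) (Fin m) ℝ :=
  if hx : ∃ C, IsMLE 𝒢 x C then hx.choose else 0

/-- The statistic `S(x)`: `n` times the maximum likelihood estimate of the covariance. -/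
def sStat (𝒢 : SimpleGraph (Fin m)) (x : Matrix (Fin m) (Fin n) ℝ) :
    Matrix (Fin m) (Fin m) ℝ :=
  (n : ℝ) • mle 𝒢 x

/-- `T`, regarded as a map with domain `D`, is a `G`-equivariant estimator of the concentration
matrix: `D` is `G`-stable, `T` maps `D` to `concCone 𝒢`, and `T (g x) = g · T x` for all `g ∈ G`
and `x ∈ D`. -/
structure IsEquivariantEstimator (𝒢 : SimpleGraph (Fin m))
    (D : Set (Matrix (Fin m) (Fin n) ℝ))
    (T : Matrix (Fin m) (Fin n) ℝ → Matrix (Fin m) (Fin m) ℝ) : Prop where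
  stable : ∀ g ∈ symmetryGroup 𝒢, ∀ x ∈ D, (g : Matrix (Fin m) (Fin m) ℝ) * x ∈ D
  mem_concCone : ∀ x ∈ D, T x ∈ concCone 𝒢
  equivariant : ∀ g ∈ symmetryGroup 𝒢, ∀ x ∈ D,
    T ((g : Matrix (Fin m) (Fin m) ℝ) * x) = act g (T x)

/-- `T` is a function of the sufficient statistic `S` on the part of its domain `D` where
`S` is defined. -/
def IsFunctionOfS (𝒢 : SimpleGraph (Fin m)) (D : Set (Matrix (Fin m) (Fin n) ℝ))
    (T : Matrix (Fin m) (Fin n) ℝ → Matrix (Fin m) (Fin m) ℝ) : Prop :=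
  ∃ τ : Matrix (Fin m) (Fin m) ℝ → Matrix (Fin m) (Fin m) ℝ,
    ∀ x ∈ D ∩ mleDomain 𝒢 n, T x = τ (sStat 𝒢 x)

/-- `h : ℝ^{m × n} → G⁰` satisfies `S(x)⁻¹ = h(x)ᵀ h(x)` at all samples where `S` is defined. -/
def IsFactorization (𝒢 : SimpleGraph (Fin m))
    (h : Matrix (Fin m) (Fin n) ℝ → identityComponent 𝒢) : Prop :=
  ∀ x ∈ mleDomain 𝒢 n, (sStat 𝒢 x)⁻¹ =
    ((h x : GL (Fin m) ℝ) : Matrix (Fin m) (Fin m) ℝ)ᵀ *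
      ((h x : GL (Fin m) ℝ) : Matrix (Fin m) (Fin m) ℝ)

end GaussianGraphical

end

set_option linter.unusedSectionVars false

/-! The heart of the matter is that `G⁰` acts transitively on the cone: every `K` in it equals `hᵀ
h` with `h ∈ G⁰`. Excluding induced 4-cycles and 4-chains makes adjacent vertices comparable for `≼`
(`vertexLE_total_of_adj`), and the vertices `≼` a given one form a chain. Cholesky elimination
carried out along this pre-order creates fill-in only at comparable pairs, so the factor has the
zero pattern of `G⁰` (`exists_eq_transpose_mul_self`).

The maximum likelihood estimate is unique because the log-likelihood is strictly concave in the
concentration matrix (`IsMLE.unique`); hence `S(gx) = g S(x) gᵀ` for `g ∈ G⁰` (`sStat_mul`).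

Fix a sample `x₀` with `S(x₀)⁻¹ = aᵀ a`. If `S(x)⁻¹ = hᵀ h`, then `a⁻¹ h x` and `x₀` have the same
`S`, hence the same value of `T`. Equivariance gives `T(x) = hᵀ (a · T(x₀)) h`, and factoring the
constant `a · T(x₀)` as `h₀ᵀ h₀` finishes the proof. -/

namespace GaussianGraphical


/-! ### Zero patterns given by a pre-order, and Cholesky factors respecting them -/

section Pattern

variable {ι : Type*} [Fintype ι] [DecidableEq ι]

/-- The matrices whose `(i, j)` entry vanishes unless `r i j`. -/
def patternSubmodule (r : ι → ι → Prop) : Submodule ℝ (Matrix ι ι ℝ) where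
  carrier := {A | ∀ i j, ¬ r i j → A i j = 0}
  add_mem' hA hB i j hij := by simp [hA i j hij, hB i j hij]
  zero_mem' := by simp
  smul_mem' c A hA i j hij := by simp [hA i j hij]

theorem mul_mem_patternSubmodule {r : ι → ι → Prop} (htrans : ∀ i j k, r i j → r j k → r i k)
    {A B : Matrix ι ι ℝ} (hA : A ∈ patternSubmodule r) (hB : B ∈ patternSubmodule r) :
    A * B ∈ patternSubmodule r := by
  intro i j hij
  rw [Matrix.mul_apply]
  refine Finset.sum_eq_zero fun k _ => ?_
  by_cases hik : r i k
  · rw [hB k j fun hkj => hij (htrans i k j hik hkj), mul_zero]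
  · rw [hA i k hik, zero_mul]

/-- The matrices with a reflexive and transitive zero pattern are closed under inversion. -/
theorem inv_mem_patternSubmodule {r : ι → ι → Prop} (hrefl : ∀ i, r i i)
    (htrans : ∀ i j k, r i j → r j k → r i k) {A : Matrix ι ι ℝ}
    (hA : A ∈ patternSubmodule r) (hu : IsUnit A) : A⁻¹ ∈ patternSubmodule r := by
  let L : patternSubmodule r →ₗ[ℝ] patternSubmodule r :=
    (LinearMap.mulLeft ℝ A).restrict fun B hB => mul_mem_patternSubmodule htrans hA hB
  -- Left multiplication by `A` is an injective endomorphism of a finite-dimensional space, hence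
  -- surjective; a preimage of `1` is the inverse, already inside the pattern.
  have hinj : Function.Injective L := by
    intro B C hBC
    have h : A * (B : Matrix ι ι ℝ) = A * (C : Matrix ι ι ℝ) := congrArg Subtype.val hBC
    exact Subtype.ext (hu.mul_left_cancel h)
  have hone : (1 : Matrix ι ι ℝ) ∈ patternSubmodule r := fun i j hij =>
    Matrix.one_apply_ne fun h => hij (h ▸ hrefl i)
  obtain ⟨B, hB⟩ := LinearMap.injective_iff_surjective.1 hinj ⟨1, hone⟩
  have h : A * (B : Matrix ι ι ℝ) = 1 := congrArg Subtype.val hB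
  rw [Matrix.inv_eq_right_inv h]
  exact B.2

/-- One step of the Cholesky decomposition: the Schur complement of a positive diagonal entry of
a positive semidefinite matrix is positive semidefinite. -/
theorem posSemidef_schur_step {K : Matrix ι ι ℝ} (hK : K.PosSemidef) {v : ι} (hv : K v v ≠ 0) :
    (K - (K v v)⁻¹ • vecMulVec (K v) (K v)).PosSemidef := by
  have hsymm : Kᵀ = K := by simpa [Matrix.IsHermitian] using hK.isHermitian
  set e : ι → ℝ := Pi.single v 1 with he
  have hKe : K *ᵥ e = K v := by
    ext i
    rw [he, mulVec_single_one]
    exact congrFun (congrFun hsymm v) i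
  have heK : e ᵥ* K = K v := by
    rw [he, single_one_vecMul]
    rfl
  have hek : e ⬝ᵥ K v = K v v := by rw [he, single_one_dotProduct]
  -- The Schur complement is the congruence transform of `K` by the column operation that clears row
  -- `v`.
  have h := hK.conjTranspose_mul_mul_same (1 - (K v v)⁻¹ • vecMulVec e (K v))
  convert h using 1
  rw [conjTranspose_eq_transpose_of_trivial, transpose_sub, transpose_one, transpose_smul,
    transpose_vecMulVec, sub_mul, one_mul, smul_mul_assoc, vecMulVec_mul, heK, mul_sub, mul_one,
    mul_smul_comm, sub_mul, mul_vecMulVec, hKe, smul_mul_assoc, vecMulVec_mul_vecMulVec,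
    dotProduct_comm, hek]
  rw [vecMulVec_smul, smul_sub, smul_smul (K v v)⁻¹ (K v v), inv_mul_cancel₀ hv, one_smul]
  abel

/-- If the zero pattern of a positive semidefinite matrix `K` with support in `s` lies in the
comparability relation of a pre-order `r` with linearly ordered up-sets, then `K = hᵀ h` for a
matrix `h` whose zero pattern lies in `r`. -/
theorem exists_eq_transpose_mul_self_of_support {r : ι → ι → Prop} (hrefl : ∀ i, r i i)
    (htrans : ∀ i j k, r i j → r j k → r i k)
    (hforest : ∀ u v w, r u v → r u w → r v w ∨ r w v) (s : Finset ι) :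
    ∀ K : Matrix ι ι ℝ, K.PosSemidef → (∀ i j, K i j ≠ 0 → r i j ∨ r j i) →
      (∀ i j, K i j ≠ 0 → i ∈ s) →
      ∃ h ∈ patternSubmodule r, (∀ i j, h i j ≠ 0 → i ∈ s) ∧ K = hᵀ * h := by
  induction s using Finset.strongInduction with
  | H s ih =>
  intro K hK hr hs
  rcases s.eq_empty_or_nonempty with rfl | hne
  · refine ⟨0, Submodule.zero_mem _, by simp, ?_⟩
    ext i j
    by_contra h
    simpa using hs i j (by simpa using h)
  -- Eliminating an `r`-minimal vertex `v` of `s` first forces row `v` of `K` to be supported in the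
  -- up-set of `v`.
  let _ : Preorder ι := { le := r, le_refl := hrefl, le_trans := htrans }
  obtain ⟨v, hvs, hmin⟩ := s.exists_minimal hne
  have hmin' : ∀ i ∈ s, r i v → r v i := fun i hi hiv => hmin hi hiv
  have hsymm : ∀ i j, K i j = K j i := fun i j => by
    simpa using (hK.isHermitian.apply i j).symm
  have hrow : ∀ j, K v j ≠ 0 → r v j := fun j hj =>
    (hr v j hj).elim id (hmin' j (hs j v (hsymm v j ▸ hj)))
  by_cases hc : K v v = 0
  -- A zero diagonal entry of a positive semidefinite matrix kills its whole row, so `v` can simply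
  -- be dropped from the support.
  · have hzero : ∀ j, K v j = 0 := by
      have h := (hK.dotProduct_mulVec_zero_iff (Pi.single v 1)).1
        (by simpa [mulVec_single_one] using hc)
      intro j
      rw [hsymm]
      simpa [mulVec_single_one] using congrFun h j
    obtain ⟨h, hh, hhs, hKh⟩ := ih (s.erase v) (Finset.erase_ssubset hvs) K hK hr
      fun i j hij => Finset.mem_erase.2 ⟨fun hiv => hij (hiv ▸ hzero j), hs i j hij⟩
    exact ⟨h, hh, fun i j hij => Finset.mem_of_mem_erase (hhs i j hij), hKh⟩
  · have hcpos : 0 < K v v := lt_of_le_of_ne hK.diag_nonneg (Ne.symm hc)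
    set K' := K - (K v v)⁻¹ • vecMulVec (K v) (K v) with hK'
    have hentry : ∀ i j, K' i j = K i j - (K v v)⁻¹ * (K v i * K v j) := fun i j => by
      simp [hK', vecMulVec_apply]
    obtain ⟨h, hh, hhs, hKh⟩ := ih (s.erase v) (Finset.erase_ssubset hvs) K'
      (posSemidef_schur_step hK hc)
      (by
        intro i j hij
        by_cases hKij : K i j = 0
        · rw [hentry, hKij] at hij
          -- Fill-in at `(i, j)` requires both `i` and `j` in the up-set of `v`, where any two
          -- elements are comparable.
          refine hforest v i j (hrow i fun h0 => hij ?_) (hrow j fun h0 => hij ?_) <;> simp [h0]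
        · exact hr i j hKij)
      (by
        intro i j hij
        refine Finset.mem_erase.2 ⟨?_, ?_⟩
        · rintro rfl
          refine hij ?_
          rw [hentry]
          field_simp
          ring
        · by_cases hKij : K i j = 0
          · rw [hentry, hKij] at hij
            have hvi : K v i ≠ 0 := fun h0 => hij (by simp [h0])
            exact hs i v (hsymm v i ▸ hvi)
          · exact hs i j hKij)
    have hhv : ∀ j, h v j = 0 := fun j => by
      by_contra hvj
      simpa using hhs v j hvj
    -- The new row `b` goes into position `v`, where `h` vanishes; the cross terms in `(h + e bᵀ)ᵀ
    -- (h + e bᵀ)` therefore disappear, and `b bᵀ` restores the subtracted rank-one part.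
    set e : ι → ℝ := Pi.single v 1 with he
    set b : ι → ℝ := (Real.sqrt (K v v))⁻¹ • K v with hb
    have hentry' : ∀ i j, (h + vecMulVec e b) i j ≠ 0 → h i j ≠ 0 ∨ (i = v ∧ K v j ≠ 0) := by
      intro i j hij
      by_cases hiv : i = v
      · subst hiv
        refine Or.inr ⟨rfl, fun h0 => hij ?_⟩
        simp [hhv, vecMulVec_apply, hb, h0]
      · refine Or.inl fun h0 => hij ?_
        simp [h0, vecMulVec_apply, he, hiv]
    refine ⟨h + vecMulVec e b, ?_, ?_, ?_⟩
    · intro i j hij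
      by_contra h0
      rcases hentry' i j h0 with h1 | ⟨rfl, h1⟩
      · exact h1 (hh i j hij)
      · exact hij (hrow j h1)
    · intro i j hij
      rcases hentry' i j hij with h1 | ⟨rfl, -⟩
      · exact Finset.mem_of_mem_erase (hhs i j h1)
      · exact hvs
    · have hhe : hᵀ *ᵥ e = 0 := by
        ext j
        simp [he, hhv]
      have heh : e ᵥ* h = 0 := by
        ext j
        simp [he, hhv]
      have hee : e ⬝ᵥ e = 1 := by simp [he]
      have hbb : vecMulVec b b = (K v v)⁻¹ • vecMulVec (K v) (K v) := by
        rw [hb, vecMulVec_smul, smul_vecMulVec, smul_smul, ← mul_inv,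
          Real.mul_self_sqrt hcpos.le]
      rw [transpose_add, transpose_vecMulVec, add_mul, mul_add, mul_add, mul_vecMulVec, hhe,
        vecMulVec_mul, heh, vecMulVec_mul_vecMulVec, hee, one_smul, hbb, ← hKh, hK']
      simp

/-- **Cholesky decomposition** without fill-in: if the zero pattern of a positive definite matrix
`K` lies in the comparability relation of a pre-order `r` with linearly ordered up-sets, then
`K = hᵀ h` for an invertible matrix `h` whose zero pattern lies in `r`. -/
theorem exists_eq_transpose_mul_self {r : ι → ι → Prop} (hrefl : ∀ i, r i i)
    (htrans : ∀ i j k, r i j → r j k → r i k)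
    (hforest : ∀ u v w, r u v → r u w → r v w ∨ r w v) {K : Matrix ι ι ℝ} (hK : K.PosDef)
    (hr : ∀ i j, K i j ≠ 0 → r i j ∨ r j i) :
    ∃ h : GL ι ℝ, (h : Matrix ι ι ℝ) ∈ patternSubmodule r ∧
      K = (h : Matrix ι ι ℝ)ᵀ * (h : Matrix ι ι ℝ) := by
  obtain ⟨h, hh, -, hKh⟩ := exists_eq_transpose_mul_self_of_support hrefl htrans hforest
    Finset.univ K hK.posSemidef hr fun i _ _ => Finset.mem_univ i
  have hdet : h.det ≠ 0 := by
    intro h0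
    have hpos := hK.det_pos
    rw [hKh, det_mul, h0, mul_zero] at hpos
    exact lt_irrefl _ hpos
  exact ⟨GeneralLinearGroup.mkOfDetNeZero h hdet, hh, hKh⟩

end Pattern

/-! ### Strict log-concavity of the determinant -/

section Determinant

variable {ι : Type*} [Fintype ι] [DecidableEq ι]

/-- The determinant of `1 + C` in terms of the eigenvalues of a symmetric matrix `C`. -/
theorem det_one_add_eq_prod_eigenvalues {C : Matrix ι ι ℝ} (hC : C.IsHermitian) :
    (1 + C).det = ∏ i, (1 + hC.eigenvalues i) := by
  -- At `-1` the characteristic polynomial is `det (-(1 + C))`; the sign `(-1)ⁿ` cancels against the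
  -- one from the linear factors.
  have h := Matrix.eval_charpoly C (-1)
  rw [hC.charpoly_eq, Polynomial.eval_prod] at h
  have h1 : scalar ι (-1 : ℝ) - C = -(1 + C) := by
    rw [map_neg, map_one]
    abel
  have h2 : ∀ i, Polynomial.eval (-1 : ℝ)
      (Polynomial.X - Polynomial.C (hC.eigenvalues i : ℝ)) = (-1) * (1 + hC.eigenvalues i) :=
    fun i => by simp; ring
  simp only [RCLike.ofReal_real_eq_id, id_eq] at h
  rw [h1, Finset.prod_congr rfl fun i _ => h2 i, Finset.prod_mul_distrib, Finset.prod_const,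
    Finset.card_univ, det_neg] at h
  exact (mul_left_cancel₀ (pow_ne_zero _ (by norm_num)) h).symm

theorem eq_one_of_eigenvalues_eq_one {C : Matrix ι ι ℝ} (hC : C.IsHermitian)
    (h : ∀ i, hC.eigenvalues i = 1) : C = 1 := by
  have h1 : diagonal ((RCLike.ofReal : ℝ → ℝ) ∘ hC.eigenvalues) = (1 : Matrix ι ι ℝ) := by
    rw [← diagonal_one]
    congr 1
    ext i
    simp [h i]
  rw [hC.spectral_theorem, h1, map_one]

/-- Eigenvalue by eigenvalue this is `4λ ≤ (1 + λ)²`, with equality only at `λ = 1`. -/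
theorem four_pow_mul_det_lt_sq_det_one_add {C : Matrix ι ι ℝ} (hC : C.PosDef) (hne : C ≠ 1) :
    4 ^ Fintype.card ι * C.det < (1 + C).det ^ 2 := by
  have hdet : C.det = ∏ i, hC.isHermitian.eigenvalues i := by
    simpa using hC.isHermitian.det_eq_prod_eigenvalues
  rw [det_one_add_eq_prod_eigenvalues hC.isHermitian, hdet, ← Finset.card_univ,
    ← Finset.prod_const, ← Finset.prod_mul_distrib, ← Finset.prod_pow]
  obtain ⟨i, hi⟩ : ∃ i, hC.isHermitian.eigenvalues i ≠ 1 := by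
    by_contra! h
    exact hne (eq_one_of_eigenvalues_eq_one _ h)
  refine Finset.prod_lt_prod (fun j _ => mul_pos (by norm_num) (hC.eigenvalues_pos j))
    (fun j _ => ?_) ⟨i, Finset.mem_univ i, ?_⟩
  · nlinarith [sq_nonneg (hC.isHermitian.eigenvalues j - 1)]
  · nlinarith [sq_pos_of_ne_zero (sub_ne_zero.2 hi)]

/-- Strict logarithmic concavity of the determinant at midpoints. -/
theorem four_pow_mul_det_mul_det_lt_sq_det_add {A B : Matrix ι ι ℝ} (hA : A.PosDef)
    (hB : B.PosDef) (hne : A ≠ B) :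
    4 ^ Fintype.card ι * (A.det * B.det) < (A + B).det ^ 2 := by
  -- With the relation that always holds, the factorization is just `A = Pᵀ P`; congruence by `P⁻¹`
  -- then reduces to the case `A = 1`.
  obtain ⟨p, -, hp⟩ := exists_eq_transpose_mul_self (r := fun _ _ => True) (fun _ => trivial)
    (fun _ _ _ _ _ => trivial) (fun _ _ _ _ _ => Or.inl trivial) hA
    (fun _ _ _ => Or.inl trivial)
  set P : Matrix ι ι ℝ := (p : Matrix ι ι ℝ) with hP
  set Q : Matrix ι ι ℝ := ((p⁻¹ : GL ι ℝ) : Matrix ι ι ℝ) with hQ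
  have hQP : Q * P = 1 := by simp [hP, hQ]
  have hPQt : Pᵀ * Qᵀ = 1 := by rw [← transpose_mul, hQP, transpose_one]
  have hBC : B = Pᵀ * (Qᵀ * B * Q) * P := by
    calc B = (Pᵀ * Qᵀ) * B * (Q * P) := by rw [hQP, hPQt, one_mul, mul_one]
      _ = _ := by simp only [Matrix.mul_assoc]
  have hC : (Qᵀ * B * Q).PosDef := by
    rw [← conjTranspose_eq_transpose_of_trivial]
    refine hB.conjTranspose_mul_mul_same ?_
    exact mulVec_injective_of_isUnit (p⁻¹).isUnit
  set C := Qᵀ * B * Q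
  have hAB : A + B = Pᵀ * (1 + C) * P := by
    rw [mul_add, add_mul, ← hBC, mul_one, ← hp]
  have hC1 : C ≠ 1 := by
    intro h
    rw [h, mul_one, ← hp] at hBC
    exact hne hBC.symm
  have hdet : P.det ≠ 0 := by
    intro h0
    have hpos := hA.det_pos
    rw [hp, det_mul, h0, mul_zero] at hpos
    exact lt_irrefl _ hpos
  have hlt := four_pow_mul_det_lt_sq_det_one_add hC hC1
  rw [hAB, hBC, hp]
  simp only [det_mul, det_transpose]
  have h4 : 0 < P.det ^ 4 := by positivity
  nlinarith [mul_lt_mul_of_pos_left hlt h4]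

end Determinant


/-! ### The vertex pre-order and the action of `G⁰` on the cone -/

section Graph

variable {m : ℕ} {𝒢 : SimpleGraph (Fin m)}

theorem vertexLE_iff {i j : Fin m} :
    VertexLE 𝒢 i j ↔ ∀ k, (k = j ∨ 𝒢.Adj j k) → (k = i ∨ 𝒢.Adj i k) := by
  simp only [VertexLE, Set.subset_def, Set.mem_union, SimpleGraph.mem_neighborSet,
    Set.mem_singleton_iff]
  exact forall_congr' fun k => imp_congr or_comm or_comm

theorem VertexLE.refl (𝒢 : SimpleGraph (Fin m)) (i : Fin m) : VertexLE 𝒢 i i := subset_rfl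

theorem VertexLE.trans {i j k : Fin m} (hij : VertexLE 𝒢 i j) (hjk : VertexLE 𝒢 j k) :
    VertexLE 𝒢 i k := Set.Subset.trans hjk hij

theorem VertexLE.eq_or_adj {i j : Fin m} (h : VertexLE 𝒢 i j) : j = i ∨ 𝒢.Adj i j :=
  vertexLE_iff.1 h j (Or.inl rfl)

/-- In a graph without induced 4-cycles and 4-chains, adjacent vertices are comparable. -/
theorem vertexLE_total_of_adj (hdec : IsDecomposable 𝒢) (hchain : NoInducedFourChain 𝒢)
    {i j : Fin m} (hij : 𝒢.Adj i j) : VertexLE 𝒢 i j ∨ VertexLE 𝒢 j i := by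
  -- Incomparability yields `b` in the closed neighbourhood of `j` but not of `i`, and `a` the other
  -- way round. Then `a, i, j, b` induce a 4-cycle if `a` and `b` are adjacent, and a 4-chain
  -- otherwise.
  by_contra! hcon
  obtain ⟨h1, h2⟩ := hcon
  rw [vertexLE_iff] at h1 h2
  push Not at h1 h2
  obtain ⟨b, hb, hbi, hbi'⟩ := h1
  obtain ⟨a, ha, haj, haj'⟩ := h2
  have hjb : 𝒢.Adj j b := hb.resolve_left fun h => hbi' (h ▸ hij)
  have hia : 𝒢.Adj i a := ha.resolve_left fun h => haj' (h ▸ hij.symm)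
  have hab : a ≠ b := fun h => haj' (h ▸ hjb)
  have hbi'' : ¬ 𝒢.Adj b i := fun h => hbi' h.symm
  have haj'' : ¬ 𝒢.Adj a j := fun h => haj' h.symm
  have hinj : Function.Injective ![a, i, j, b] := by
    intro x y hxy
    fin_cases x <;> fin_cases y <;>
      simp_all [hij.ne, hij.ne', hia.ne, hia.ne', hjb.ne, hjb.ne', hab.symm, hbi.symm, haj.symm]
  by_cases habadj : 𝒢.Adj a b
  · refine hdec 4 le_rfl ⟨⟨⟨![a, i, j, b], hinj⟩, ?_⟩⟩
    intro x y
    have hcycle : ∀ x y : Fin 4, (SimpleGraph.cycleGraph 4).Adj x y ↔ x - y = 1 ∨ y - x = 1 :=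
      fun x y => SimpleGraph.cycleGraph_adj
    fin_cases x <;> fin_cases y <;> rw [hcycle] <;>
      simp [hij, hij.symm, hia, hia.symm, hjb, hjb.symm, habadj, habadj.symm, hbi', hbi'',
        haj', haj''] <;> decide
  · have hba : ¬ 𝒢.Adj b a := fun h => habadj h.symm
    refine hchain ⟨⟨⟨![a, i, j, b], hinj⟩, ?_⟩⟩
    intro x y
    fin_cases x <;> fin_cases y <;>
      simp [SimpleGraph.pathGraph_adj, hij, hij.symm, hia, hia.symm, hjb, hjb.symm, habadj, hba,
        hbi', hbi'', haj', haj'']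

theorem mem_identityComponent_iff {g : GL (Fin m) ℝ} :
    g ∈ identityComponent 𝒢 ↔
      (g : Matrix (Fin m) (Fin m) ℝ) ∈ patternSubmodule fun i j => VertexLE 𝒢 j i := Iff.rfl

theorem one_mem_identityComponent : (1 : GL (Fin m) ℝ) ∈ identityComponent 𝒢 := fun i _ hij =>
  Matrix.one_apply_ne fun h => hij (h ▸ VertexLE.refl 𝒢 i)

theorem mul_mem_identityComponent {g h : GL (Fin m) ℝ} (hg : g ∈ identityComponent 𝒢)
    (hh : h ∈ identityComponent 𝒢) : g * h ∈ identityComponent 𝒢 :=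
  mul_mem_patternSubmodule (r := fun i j => VertexLE 𝒢 j i)
    (fun _ _ _ hij hjk => hjk.trans hij) hg hh

theorem inv_mem_identityComponent {g : GL (Fin m) ℝ} (hg : g ∈ identityComponent 𝒢) :
    g⁻¹ ∈ identityComponent 𝒢 := by
  rw [mem_identityComponent_iff, coe_units_inv]
  exact inv_mem_patternSubmodule (r := fun i j => VertexLE 𝒢 j i) (VertexLE.refl 𝒢)
    (fun _ _ _ hij hjk => hjk.trans hij) hg g.isUnit

/-- Write `N[i]` for the closed neighbourhood. A nonzero term `g k i * K k l * g l j` needs `i ≼ k`,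
`j ≼ l` and `l ∈ N[k]`. Then `l ∈ N[k] ⊆ N[i]`, so `i ∈ N[l] ⊆ N[j]`, and the entry `(i, j)` is
allowed. -/
theorem transpose_mul_mul_mem_concCone {g : GL (Fin m) ℝ} (hg : g ∈ identityComponent 𝒢)
    {K : Matrix (Fin m) (Fin m) ℝ} (hK : K ∈ concCone 𝒢) :
    (g : Matrix (Fin m) (Fin m) ℝ)ᵀ * K * (g : Matrix (Fin m) (Fin m) ℝ) ∈ concCone 𝒢 := by
  refine ⟨⟨?_, ?_⟩, ?_⟩
  · rw [IsSymm, transpose_mul, transpose_mul, transpose_transpose, hK.1.1.eq, Matrix.mul_assoc]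
  · intro i j hij hadj
    simp only [Matrix.mul_apply, transpose_apply, Finset.sum_mul]
    refine Finset.sum_eq_zero fun l _ => Finset.sum_eq_zero fun k _ => ?_
    by_cases hki : VertexLE 𝒢 i k
    · by_cases hlj : VertexLE 𝒢 j l
      · have hkl : K k l = 0 := by
          by_contra hne
          have h1 : l = k ∨ 𝒢.Adj k l := by
            by_contra! h
            exact hne (hK.1.2 k l (Ne.symm h.1) h.2)
          have h2 := vertexLE_iff.1 hki l h1
          have h3 := vertexLE_iff.1 hlj i (h2.imp Eq.symm SimpleGraph.Adj.symm)
          exact h3.elim hij fun h => hadj h.symm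
        rw [hkl, mul_zero, zero_mul]
      · rw [hg l j hlj, mul_zero]
    · rw [hg k i hki, zero_mul, zero_mul]
  · rw [← conjTranspose_eq_transpose_of_trivial]
    exact hK.2.conjTranspose_mul_mul_same (mulVec_injective_of_isUnit g.isUnit)

theorem act_mem_concCone {g : GL (Fin m) ℝ} (hg : g ∈ identityComponent 𝒢)
    {K : Matrix (Fin m) (Fin m) ℝ} (hK : K ∈ concCone 𝒢) : act g K ∈ concCone 𝒢 :=
  transpose_mul_mul_mem_concCone (inv_mem_identityComponent hg) hK

theorem identityComponent_subset_symmetryGroup : identityComponent 𝒢 ⊆ symmetryGroup 𝒢 :=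
  fun _ hg _ hK => act_mem_concCone hg hK

/-- For a decomposable graph without induced 4-chains, `G⁰` acts transitively on the cone. -/
theorem exists_eq_transpose_mul_self_of_mem_concCone (hdec : IsDecomposable 𝒢)
    (hchain : NoInducedFourChain 𝒢) {K : Matrix (Fin m) (Fin m) ℝ} (hK : K ∈ concCone 𝒢) :
    ∃ h ∈ identityComponent 𝒢,
      K = (h : Matrix (Fin m) (Fin m) ℝ)ᵀ * (h : Matrix (Fin m) (Fin m) ℝ) := by
  have htot : ∀ i j, j = i ∨ 𝒢.Adj i j → VertexLE 𝒢 j i ∨ VertexLE 𝒢 i j := by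
    rintro i j (rfl | h)
    · exact Or.inl (VertexLE.refl 𝒢 _)
    · exact vertexLE_total_of_adj hdec hchain h.symm
  -- The relation is `≼` reversed, so the up-set of `u` consists of the `v ≼ u`. If also `w ≼ u`,
  -- then `w` lies in the closed neighbourhood of `u`, hence in that of `v`, and adjacency gives
  -- comparability.
  refine exists_eq_transpose_mul_self (r := fun i j => VertexLE 𝒢 j i) (VertexLE.refl 𝒢)
    (fun _ _ _ hij hjk => hjk.trans hij) (fun u v w huv huw => ?_) hK.2 fun i j hij => ?_
  · exact htot v w (vertexLE_iff.1 huv w (huw.eq_or_adj.imp Eq.symm SimpleGraph.Adj.symm))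
  · refine htot i j ?_
    by_contra! h
    exact hij (hK.1.2 i j (Ne.symm h.1) h.2)

end Graph

/-! ### Equivariance and uniqueness of the maximum likelihood estimate -/

section Likelihood

variable {m n : ℕ} {𝒢 : SimpleGraph (Fin m)}

theorem gaussianDensity_conj (g : GL (Fin m) ℝ) (C : Matrix (Fin m) (Fin m) ℝ) (v : Fin m → ℝ) :
    gaussianDensity ((g : Matrix (Fin m) (Fin m) ℝ) * C * (g : Matrix (Fin m) (Fin m) ℝ)ᵀ)
      ((g : Matrix (Fin m) (Fin m) ℝ) *ᵥ v) =
      |(g : Matrix (Fin m) (Fin m) ℝ).det|⁻¹ * gaussianDensity C v := by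
  set A : Matrix (Fin m) (Fin m) ℝ := (g : Matrix (Fin m) (Fin m) ℝ) with hA
  have hAd : IsUnit A.det := (isUnit_iff_isUnit_det A).1 g.isUnit
  have hdet : (2 * Real.pi) ^ m * (A * C * Aᵀ).det =
      (2 * Real.pi) ^ m * C.det * A.det ^ 2 := by
    rw [det_mul, det_mul, det_transpose]
    ring
  have hquad : (A *ᵥ v) ⬝ᵥ ((A * C * Aᵀ)⁻¹ *ᵥ (A *ᵥ v)) = v ⬝ᵥ (C⁻¹ *ᵥ v) := by
    have h1 : Aᵀ * (A * C * Aᵀ)⁻¹ * A = C⁻¹ := by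
      rw [Matrix.mul_inv_rev, Matrix.mul_inv_rev, ← Matrix.mul_assoc, ← Matrix.mul_assoc,
        mul_nonsing_inv _ (by rwa [det_transpose]), one_mul, Matrix.mul_assoc,
        nonsing_inv_mul _ hAd, mul_one]
    rw [← h1, ← mulVec_mulVec, ← mulVec_mulVec, dotProduct_mulVec v, vecMul_transpose]
  rw [gaussianDensity, gaussianDensity, hdet, hquad, Real.sqrt_mul' _ (sq_nonneg _),
    Real.sqrt_sq_eq_abs, mul_inv]
  ring

theorem likelihood_conj (g : GL (Fin m) ℝ) (x : Matrix (Fin m) (Fin n) ℝ)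
    (C : Matrix (Fin m) (Fin m) ℝ) :
    likelihood ((g : Matrix (Fin m) (Fin m) ℝ) * x)
      ((g : Matrix (Fin m) (Fin m) ℝ) * C * (g : Matrix (Fin m) (Fin m) ℝ)ᵀ) =
      |(g : Matrix (Fin m) (Fin m) ℝ).det|⁻¹ ^ n * likelihood x C := by
  have h : ∀ k : Fin n, gaussianDensity
      ((g : Matrix (Fin m) (Fin m) ℝ) * C * (g : Matrix (Fin m) (Fin m) ℝ)ᵀ)
      (fun i => ((g : Matrix (Fin m) (Fin m) ℝ) * x) i k) =
      |(g : Matrix (Fin m) (Fin m) ℝ).det|⁻¹ * gaussianDensity C (fun i => x i k) := fun k =>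
    gaussianDensity_conj g C fun i => x i k
  rw [likelihood, likelihood, Finset.prod_congr rfl fun k _ => h k, Finset.prod_mul_distrib]
  simp

theorem conj_mem_modelCov {g : GL (Fin m) ℝ} (hg : g ∈ identityComponent 𝒢)
    {C : Matrix (Fin m) (Fin m) ℝ} (hC : C ∈ modelCov 𝒢) :
    (g : Matrix (Fin m) (Fin m) ℝ) * C * (g : Matrix (Fin m) (Fin m) ℝ)ᵀ ∈ modelCov 𝒢 := by
  have h : ((g : Matrix (Fin m) (Fin m) ℝ) * C * (g : Matrix (Fin m) (Fin m) ℝ)ᵀ)⁻¹ =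
      act g C⁻¹ := by
    rw [act, coe_units_inv, Matrix.mul_inv_rev, Matrix.mul_inv_rev, transpose_nonsing_inv,
      Matrix.mul_assoc]
  have hmem := act_mem_concCone hg hC.2
  rw [← h] at hmem
  exact ⟨posDef_inv_iff.1 hmem.2, hmem⟩

/-- `G⁰` permutes the model, and the likelihood changes only by a factor independent of `C`, so
maximizers go to maximizers. -/
theorem IsMLE.conj {g : GL (Fin m) ℝ} (hg : g ∈ identityComponent 𝒢)
    {x : Matrix (Fin m) (Fin n) ℝ} {C : Matrix (Fin m) (Fin m) ℝ} (hC : IsMLE 𝒢 x C) :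
    IsMLE 𝒢 ((g : Matrix (Fin m) (Fin m) ℝ) * x)
      ((g : Matrix (Fin m) (Fin m) ℝ) * C * (g : Matrix (Fin m) (Fin m) ℝ)ᵀ) := by
  refine ⟨conj_mem_modelCov hg hC.1, fun C' hC' => ?_⟩
  have hmax := hC.2 (conj_mem_modelCov (inv_mem_identityComponent hg) hC')
  have hC'' : C' = (g : Matrix (Fin m) (Fin m) ℝ) *
      (((g⁻¹ : GL (Fin m) ℝ) : Matrix (Fin m) (Fin m) ℝ) * C' *
        ((g⁻¹ : GL (Fin m) ℝ) : Matrix (Fin m) (Fin m) ℝ)ᵀ) *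
      (g : Matrix (Fin m) (Fin m) ℝ)ᵀ := by
    have h1 : (g : Matrix (Fin m) (Fin m) ℝ) *
        ((g⁻¹ : GL (Fin m) ℝ) : Matrix (Fin m) (Fin m) ℝ) = 1 := by
      rw [← Units.val_mul, mul_inv_cancel, Units.val_one]
    have h2 : ((g⁻¹ : GL (Fin m) ℝ) : Matrix (Fin m) (Fin m) ℝ)ᵀ *
        (g : Matrix (Fin m) (Fin m) ℝ)ᵀ = 1 := by
      rw [← transpose_mul, h1, transpose_one]
    rw [Matrix.mul_assoc, Matrix.mul_assoc, Matrix.mul_assoc, h2, mul_one, ← Matrix.mul_assoc, h1,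
      one_mul]
  rw [Set.mem_ofPred_eq, hC'', likelihood_conj, likelihood_conj]
  exact mul_le_mul_of_nonneg_left hmax (by positivity)

theorem gaussianDensity_pos {C : Matrix (Fin m) (Fin m) ℝ} (hC : C.PosDef) (v : Fin m → ℝ) :
    0 < gaussianDensity C v := by
  have := hC.det_pos
  have := Real.pi_pos
  rw [gaussianDensity]
  positivity

theorem likelihood_pos {C : Matrix (Fin m) (Fin m) ℝ} (hC : C.PosDef)
    (x : Matrix (Fin m) (Fin n) ℝ) : 0 < likelihood x C :=
  Finset.prod_pos fun _ _ => gaussianDensity_pos hC _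

/-- Squaring removes the square root: in terms of `C⁻¹` there remains a power of the determinant
times the exponential of a linear function. -/
theorem likelihood_sq {C : Matrix (Fin m) (Fin m) ℝ} (hC : C.PosDef)
    (x : Matrix (Fin m) (Fin n) ℝ) :
    likelihood x C ^ 2 = (((2 * Real.pi) ^ m)⁻¹ * C⁻¹.det) ^ n *
      Real.exp (-∑ k, (fun i => x i k) ⬝ᵥ (C⁻¹ *ᵥ fun i => x i k)) := by
  have hdet := hC.det_pos
  have hpi := Real.pi_pos
  have h : ∀ v, gaussianDensity C v ^ 2 =
      (((2 * Real.pi) ^ m)⁻¹ * C⁻¹.det) * Real.exp (-(v ⬝ᵥ (C⁻¹ *ᵥ v))) := by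
    intro v
    rw [gaussianDensity, mul_pow, inv_pow, Real.sq_sqrt (by positivity), ← Real.exp_nat_mul,
      det_nonsing_inv, Ring.inverse_eq_inv', mul_inv]
    congr 2
    push_cast
    ring
  rw [likelihood, ← Finset.prod_pow, Finset.prod_congr rfl fun k _ => h _,
    Finset.prod_mul_distrib, ← Real.exp_sum, Finset.sum_neg_distrib]
  simp

theorem concCone_midpoint {K L : Matrix (Fin m) (Fin m) ℝ} (hK : K ∈ concCone 𝒢)
    (hL : L ∈ concCone 𝒢) : (2⁻¹ : ℝ) • (K + L) ∈ concCone 𝒢 := by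
  refine ⟨⟨(hK.1.1.add hL.1.1).smul _, fun i j hij hadj => ?_⟩,
    (hK.2.add hL.2).smul (by norm_num)⟩
  simp [hK.1.2 i j hij hadj, hL.1.2 i j hij hadj]

/-- The maximum likelihood estimate is unique. -/
theorem IsMLE.unique (hn : 0 < n) {x : Matrix (Fin m) (Fin n) ℝ}
    {C₁ C₂ : Matrix (Fin m) (Fin m) ℝ} (h₁ : IsMLE 𝒢 x C₁) (h₂ : IsMLE 𝒢 x C₂) : C₁ = C₂ := by
  by_contra hne
  have hpi := Real.pi_pos
  -- The midpoint is taken between concentration matrices, which form a convex cone. The exponential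
  -- factors of the likelihood balance exactly there, and the determinant factor is strictly larger.
  set K := (2⁻¹ : ℝ) • (C₁⁻¹ + C₂⁻¹) with hKdef
  have hK : K ∈ concCone 𝒢 := concCone_midpoint h₁.1.2 h₂.1.2
  have hKK : K⁻¹⁻¹ = K := nonsing_inv_nonsing_inv _ hK.2.det_pos.ne'.isUnit
  have hC : K⁻¹ ∈ modelCov 𝒢 := ⟨hK.2.inv, hKK.symm ▸ hK⟩
  have hinvne : C₁⁻¹ ≠ C₂⁻¹ := fun h => hne <| by
    rw [← nonsing_inv_nonsing_inv C₁ h₁.1.1.det_pos.ne'.isUnit, h,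
      nonsing_inv_nonsing_inv C₂ h₂.1.1.det_pos.ne'.isUnit]
  have hdet : C₁⁻¹.det * C₂⁻¹.det < K.det ^ 2 := by
    have h := four_pow_mul_det_mul_det_lt_sq_det_add h₁.1.2.2 h₂.1.2.2 hinvne
    have h4 : K.det ^ 2 = (4 ^ m)⁻¹ * (C₁⁻¹ + C₂⁻¹).det ^ 2 := by
      rw [hKdef, det_smul, Fintype.card_fin, mul_pow, ← pow_mul, mul_comm m 2, pow_mul, ← inv_pow]
      norm_num
    rw [Fintype.card_fin] at h
    rw [h4, lt_inv_mul_iff₀ (by positivity)]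
    exact h
  have hle₁ : likelihood x K⁻¹ ≤ likelihood x C₁ := h₁.2 hC
  have hle₂ : likelihood x K⁻¹ ≤ likelihood x C₂ := h₂.2 hC
  have hpos := likelihood_pos hC.1 x
  have hle : likelihood x K⁻¹ ^ 2 * likelihood x K⁻¹ ^ 2 ≤
      likelihood x C₁ ^ 2 * likelihood x C₂ ^ 2 := by gcongr
  rw [likelihood_sq hC.1, likelihood_sq h₁.1.1, likelihood_sq h₂.1.1, hKK] at hle
  have hquad : ∀ v : Fin m → ℝ, v ⬝ᵥ (K *ᵥ v) + v ⬝ᵥ (K *ᵥ v) =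
      v ⬝ᵥ (C₁⁻¹ *ᵥ v) + v ⬝ᵥ (C₂⁻¹ *ᵥ v) := by
    intro v
    rw [hKdef, smul_mulVec, add_mulVec, dotProduct_smul, dotProduct_add, smul_eq_mul]
    ring
  have hexp : Real.exp (-∑ k, (fun i => x i k) ⬝ᵥ (K *ᵥ fun i => x i k)) *
      Real.exp (-∑ k, (fun i => x i k) ⬝ᵥ (K *ᵥ fun i => x i k)) =
      Real.exp (-∑ k, (fun i => x i k) ⬝ᵥ (C₁⁻¹ *ᵥ fun i => x i k)) *
      Real.exp (-∑ k, (fun i => x i k) ⬝ᵥ (C₂⁻¹ *ᵥ fun i => x i k)) := by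
    rw [← Real.exp_add, ← Real.exp_add, ← neg_add, ← neg_add, ← Finset.sum_add_distrib,
      ← Finset.sum_add_distrib, Finset.sum_congr rfl fun k _ => hquad _]
  rw [mul_mul_mul_comm, hexp, mul_mul_mul_comm ((_ * C₁⁻¹.det) ^ n), ← mul_pow, ← mul_pow] at hle
  refine absurd hle (not_le.2 ?_)
  have hd₁ := h₁.1.2.2.det_pos
  have hd₂ := h₂.1.2.2.det_pos
  refine mul_lt_mul_of_pos_right ?_ (by positivity)
  -- Strictness survives because there is at least one observation; for `n = 0` the likelihood is
  -- constant.
  refine pow_lt_pow_left₀ ?_ (by positivity) hn.ne'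
  rw [mul_mul_mul_comm _ C₁⁻¹.det, mul_mul_mul_comm _ K.det, ← sq K.det]
  exact mul_lt_mul_of_pos_left hdet (by positivity)

theorem isMLE_mle {x : Matrix (Fin m) (Fin n) ℝ} (hx : x ∈ mleDomain 𝒢 n) :
    IsMLE 𝒢 x (mle 𝒢 x) := by
  have hx' : ∃ C, IsMLE 𝒢 x C := hx
  rw [mle, dif_pos hx']
  exact hx'.choose_spec

theorem mul_mem_mleDomain {g : GL (Fin m) ℝ} (hg : g ∈ identityComponent 𝒢)
    {x : Matrix (Fin m) (Fin n) ℝ} (hx : x ∈ mleDomain 𝒢 n) :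
    (g : Matrix (Fin m) (Fin m) ℝ) * x ∈ mleDomain 𝒢 n :=
  ⟨_, (isMLE_mle hx).conj hg⟩

/-- `mle` is an arbitrary choice of maximizer; only uniqueness makes it equivariant. -/
theorem sStat_mul (hn : 0 < n) {g : GL (Fin m) ℝ} (hg : g ∈ identityComponent 𝒢)
    {x : Matrix (Fin m) (Fin n) ℝ} (hx : x ∈ mleDomain 𝒢 n) :
    sStat 𝒢 ((g : Matrix (Fin m) (Fin m) ℝ) * x) =
      (g : Matrix (Fin m) (Fin m) ℝ) * sStat 𝒢 x * (g : Matrix (Fin m) (Fin m) ℝ)ᵀ := by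
  rw [sStat, sStat, (isMLE_mle (mul_mem_mleDomain hg hx)).unique hn ((isMLE_mle hx).conj hg),
    mul_smul_comm, smul_mul_assoc]

theorem sStat_inv_mem_concCone (hn : 0 < n) {x : Matrix (Fin m) (Fin n) ℝ}
    (hx : x ∈ mleDomain 𝒢 n) : (sStat 𝒢 x)⁻¹ ∈ concCone 𝒢 := by
  have hC := (isMLE_mle hx).1
  have hn' : (0 : ℝ) < n := by exact_mod_cast hn
  have h : (sStat 𝒢 x)⁻¹ = (n : ℝ)⁻¹ • (mle 𝒢 x)⁻¹ := by
    refine inv_eq_left_inv ?_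
    rw [sStat, smul_mul_assoc, mul_smul_comm, smul_smul, inv_mul_cancel₀ hn'.ne', one_smul,
      nonsing_inv_mul _ hC.1.det_pos.ne'.isUnit]
  rw [h]
  refine ⟨⟨hC.2.1.1.smul _, fun i j hij hadj => ?_⟩, hC.2.2.smul (by positivity)⟩
  simp [hC.2.1.2 i j hij hadj]

/-- The orbit of `x` under `G⁰` meets the fibre of `S` over `S(x₀)`. -/
theorem sStat_inv_mul_mul (hn : 0 < n) {a h : GL (Fin m) ℝ} (ha : a ∈ identityComponent 𝒢)
    (hh : h ∈ identityComponent 𝒢) {x₀ x : Matrix (Fin m) (Fin n) ℝ}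
    (hx₀ : x₀ ∈ mleDomain 𝒢 n) (hx : x ∈ mleDomain 𝒢 n)
    (hax : (sStat 𝒢 x₀)⁻¹ =
      (a : Matrix (Fin m) (Fin m) ℝ)ᵀ * (a : Matrix (Fin m) (Fin m) ℝ))
    (hhx : (sStat 𝒢 x)⁻¹ =
      (h : Matrix (Fin m) (Fin m) ℝ)ᵀ * (h : Matrix (Fin m) (Fin m) ℝ)) :
    sStat 𝒢 (((a⁻¹ * h : GL (Fin m) ℝ) : Matrix (Fin m) (Fin m) ℝ) * x) = sStat 𝒢 x₀ := by
  have hinv : ∀ {y : Matrix (Fin m) (Fin n) ℝ}, y ∈ mleDomain 𝒢 n →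
      ∀ {b : GL (Fin m) ℝ}, (sStat 𝒢 y)⁻¹ =
        (b : Matrix (Fin m) (Fin m) ℝ)ᵀ * (b : Matrix (Fin m) (Fin m) ℝ) →
      sStat 𝒢 y = ((b⁻¹ : GL (Fin m) ℝ) : Matrix (Fin m) (Fin m) ℝ) *
        ((b⁻¹ : GL (Fin m) ℝ) : Matrix (Fin m) (Fin m) ℝ)ᵀ := by
    intro y hy b hb
    have hu : IsUnit (sStat 𝒢 y).det := by
      rw [← isUnit_nonsing_inv_det_iff]
      exact (sStat_inv_mem_concCone hn hy).2.det_pos.ne'.isUnit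
    rw [← nonsing_inv_nonsing_inv _ hu, hb, Matrix.mul_inv_rev, coe_units_inv,
      transpose_nonsing_inv]
  -- With `S(x) = h⁻¹ h⁻ᵀ`, conjugation by `a⁻¹ h` leaves `a⁻¹ a⁻ᵀ = S(x₀)`.
  rw [sStat_mul hn (mul_mem_identityComponent (inv_mem_identityComponent ha) hh) hx,
    hinv hx₀ hax, hinv hx hhx, Matrix.mul_assoc, Matrix.mul_assoc, ← transpose_mul,
    ← Matrix.mul_assoc, ← Units.val_mul, mul_assoc, mul_inv_cancel, mul_one]

end Likelihood

/-! ### Equivariant estimators that factor through `S` -/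

section Equivariant

variable {m n : ℕ} {𝒢 : SimpleGraph (Fin m)}

theorem eq_transpose_mul_mul_of_act_eq {g : GL (Fin m) ℝ} {K L : Matrix (Fin m) (Fin m) ℝ}
    (h : act g K = L) :
    K = (g : Matrix (Fin m) (Fin m) ℝ)ᵀ * L * (g : Matrix (Fin m) (Fin m) ℝ) := by
  have h1 : ((g⁻¹ : GL (Fin m) ℝ) : Matrix (Fin m) (Fin m) ℝ) *
      (g : Matrix (Fin m) (Fin m) ℝ) = 1 := by
    rw [← Units.val_mul, inv_mul_cancel, Units.val_one]
  rw [← h, act, Matrix.mul_assoc, Matrix.mul_assoc, h1, mul_one, ← Matrix.mul_assoc,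
    ← transpose_mul, h1, transpose_one, one_mul]

/-- An equivariant estimator that depends on the sample only through `S` is determined by its
value at one sample `x₀`. -/
theorem IsEquivariantEstimator.eq_transpose_mul_mul (hn : 0 < n)
    {D : Set (Matrix (Fin m) (Fin n) ℝ)}
    {T : Matrix (Fin m) (Fin n) ℝ → Matrix (Fin m) (Fin m) ℝ}
    (hT : IsEquivariantEstimator 𝒢 D T) (hS : IsFunctionOfS 𝒢 D T)
    {a h : GL (Fin m) ℝ} {x₀ x : Matrix (Fin m) (Fin n) ℝ}
    (ha : a ∈ identityComponent 𝒢) (hx₀ : x₀ ∈ D ∩ mleDomain 𝒢 n)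
    (hax : (sStat 𝒢 x₀)⁻¹ =
      (a : Matrix (Fin m) (Fin m) ℝ)ᵀ * (a : Matrix (Fin m) (Fin m) ℝ))
    (hh : h ∈ identityComponent 𝒢) (hx : x ∈ D ∩ mleDomain 𝒢 n)
    (hhx : (sStat 𝒢 x)⁻¹ =
      (h : Matrix (Fin m) (Fin m) ℝ)ᵀ * (h : Matrix (Fin m) (Fin m) ℝ)) :
    T x = (h : Matrix (Fin m) (Fin m) ℝ)ᵀ * act a (T x₀) *
      (h : Matrix (Fin m) (Fin m) ℝ) := by
  obtain ⟨τ, hτ⟩ := hS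
  have hg := mul_mem_identityComponent (inv_mem_identityComponent ha) hh
  have hgG := identityComponent_subset_symmetryGroup hg
  -- The samples `a⁻¹ h x` and `x₀` share the value of `S`, so `T` agrees on them; stability of `D`
  -- and of the domain of `S` makes `τ` applicable to both.
  have hact : act (a⁻¹ * h) (T x) = T x₀ := by
    rw [← hT.equivariant _ hgG x hx.1,
      hτ _ ⟨hT.stable _ hgG x hx.1, mul_mem_mleDomain hg hx.2⟩,
      sStat_inv_mul_mul hn ha hh hx₀.2 hx.2 hax hhx, ← hτ x₀ hx₀]
  rw [eq_transpose_mul_mul_of_act_eq hact, act, Units.val_mul, transpose_mul]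
  simp only [Matrix.mul_assoc]

end Equivariant

end GaussianGraphical

theorem mainTheorem10 {m n : ℕ} (hn : 0 < n) (𝒢 : SimpleGraph (Fin m))
    (hdec : GaussianGraphical.IsDecomposable 𝒢)
    (hchain : GaussianGraphical.NoInducedFourChain 𝒢) :
    (∃ h : Matrix (Fin m) (Fin n) ℝ → GaussianGraphical.identityComponent 𝒢,
      GaussianGraphical.IsFactorization 𝒢 h) ∧
    ∀ (D : Set (Matrix (Fin m) (Fin n) ℝ))
      (T : Matrix (Fin m) (Fin n) ℝ → Matrix (Fin m) (Fin m) ℝ),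
      GaussianGraphical.IsEquivariantEstimator 𝒢 D T →
      GaussianGraphical.IsFunctionOfS 𝒢 D T →
      ∃ h₀ : GaussianGraphical.identityComponent 𝒢,
        ∀ h : Matrix (Fin m) (Fin n) ℝ → GaussianGraphical.identityComponent 𝒢,
          GaussianGraphical.IsFactorization 𝒢 h →
          ∀ x ∈ D ∩ GaussianGraphical.mleDomain 𝒢 n,
            T x =
              (((h₀ : GL (Fin m) ℝ) : Matrix (Fin m) (Fin m) ℝ) *
                ((h x : GL (Fin m) ℝ) : Matrix (Fin m) (Fin m) ℝ))ᵀ *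
              (((h₀ : GL (Fin m) ℝ) : Matrix (Fin m) (Fin m) ℝ) *
                ((h x : GL (Fin m) ℝ) : Matrix (Fin m) (Fin m) ℝ)) := by
  constructor
  · choose! f hf hfK using fun K hK =>
      GaussianGraphical.exists_eq_transpose_mul_self_of_mem_concCone (K := K) hdec hchain hK
    classical
    refine ⟨fun x => if hx : x ∈ GaussianGraphical.mleDomain 𝒢 n then
      ⟨f (GaussianGraphical.sStat 𝒢 x)⁻¹,
        hf _ (GaussianGraphical.sStat_inv_mem_concCone hn hx)⟩
      else ⟨1, GaussianGraphical.one_mem_identityComponent⟩, fun x hx => ?_⟩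
    simp only [dif_pos hx]
    exact hfK _ (GaussianGraphical.sStat_inv_mem_concCone hn hx)
  · intro D T hT hS
    rcases (D ∩ GaussianGraphical.mleDomain 𝒢 n).eq_empty_or_nonempty with hempty | ⟨x₀, hx₀⟩
    · exact ⟨⟨1, GaussianGraphical.one_mem_identityComponent⟩, fun h _ x hx =>
        absurd (hempty ▸ hx) (Set.notMem_empty x)⟩
    obtain ⟨a, ha, hax⟩ := GaussianGraphical.exists_eq_transpose_mul_self_of_mem_concCone hdec
      hchain (GaussianGraphical.sStat_inv_mem_concCone hn hx₀.2)
    -- `h₀` is built from `a` and `T x₀` alone, so it serves every factorization `h` at once.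
    obtain ⟨h₀, hh₀, hT₀⟩ := GaussianGraphical.exists_eq_transpose_mul_self_of_mem_concCone hdec
      hchain (GaussianGraphical.act_mem_concCone ha (hT.mem_concCone x₀ hx₀.1))
    refine ⟨⟨h₀, hh₀⟩, fun h hh x hx => ?_⟩
    rw [hT.eq_transpose_mul_mul hn hS ha hx₀ hax (h x).2 hx (hh x hx.2), hT₀, transpose_mul]
    simp only [Matrix.mul_assoc]
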